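/- A permutation is a finite word over the positive integers without repeated letters, and $S_n$ is the set of permutations whose letters are exactly $1,\dots,n$. West's stack-sorting map $s$ is defined recursively on permutations: $s$ sends the empty permutation to itself, and if $\pi=LmR$ where $m$ is the largest letter of $\pi$, then $s(\pi)=s(L)\,s(R)\,m$. A permutation $\pi$ is *uniquely sorted* if it has exactly one preimage under $s$. A permutation $\sigma$ *contains* a pattern $\tau$ if some (not necessarily contiguous) subsequence of $\sigma$ has the same relative order as $\tau$; otherwise $\sigma$ *avoids* $\tau$. Let $\mathcal U_n(312,1342)$ be the set of uniquely sorted permutations in $S_n$ that avoid both $312$ and $1342$. Then for every nonnegative integer $k$, \[ |\mathcal U_{2k+1}(312,1342)|=\frac{1}{2k+1}\binom{3k}{k}. \] -/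

import Mathlib

namespace StackSorting

/-- A permutation is a finite word over the positive integers without repeated letters. -/
def IsPermutation (π : List ℕ) : Prop :=
  π.Nodup ∧ ∀ x ∈ π, 0 < x

/-- `S n` is the set of permutations of `[n] = {1, …, n}`, in one-line notation. -/
def S (n : ℕ) : Set (List ℕ) :=
  {π | π.Nodup ∧ ∀ x, x ∈ π ↔ 1 ≤ x ∧ x ≤ n}

/-- The largest letter of a nonempty word occurs in it (needed for termination below). -/
theorem idxOf_max_lt {π : List ℕ} (h : π ≠ []) : π.idxOf (π.max h) < π.length :=
  List.idxOf_lt_length_iff.2 (List.max_mem h)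

/-- West's stack-sorting map: the empty word is sent to itself, and a word `L m R` with largest
letter `m` is sent to `s(L) s(R) m`. -/
def stackSort (π : List ℕ) : List ℕ :=
  if h : π = [] then []
  else
    stackSort (π.take (π.idxOf (π.max h))) ++
      stackSort (π.drop (π.idxOf (π.max h) + 1)) ++ [π.max h]
termination_by π.length
decreasing_by
  · have := idxOf_max_lt h
    simp only [List.length_take]
    omega
  · have := idxOf_max_lt h
    simp only [List.length_drop]
    omega

/-- The fertility of `π` is the number of permutations that the stack-sorting map sends to `π`. -/
noncomputable def fertility (π : List ℕ) : ℕ :=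
  {σ : List ℕ | IsPermutation σ ∧ stackSort σ = π}.ncard

/-- A permutation is uniquely sorted if its fertility is `1`. -/
def UniquelySorted (π : List ℕ) : Prop :=
  fertility π = 1

/-- The normalization of a permutation: its `i`-th smallest letter is replaced by `i`. -/
def normalization (π : List ℕ) : List ℕ :=
  π.map fun x => π.countP fun y => y ≤ x

/-- Two permutations have the same relative order if their normalizations are equal. -/
def SameRelativeOrder (σ τ : List ℕ) : Prop :=
  normalization σ = normalization τ

/-- `σ` contains the pattern `τ` if some subsequence of `σ` (not necessarily contiguous) has the
same relative order as `τ`. -/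
def Contains (σ τ : List ℕ) : Prop :=
  ∃ ρ : List ℕ, ρ.Sublist σ ∧ SameRelativeOrder ρ τ

/-- `σ` avoids the pattern `τ`. -/
def Avoids (σ τ : List ℕ) : Prop :=
  ¬ Contains σ τ

/-- `U n P` is the set of uniquely sorted permutations in `S n` avoiding all patterns in `P`. -/
def U (n : ℕ) (P : Set (List ℕ)) : Set (List ℕ) :=
  {π | π ∈ S n ∧ UniquelySorted π ∧ ∀ τ ∈ P, Avoids π τ}

end StackSorting

namespace StackSorting

/-! The count rests on three facts. (1) A nonempty word is uniquely sorted iff it is sorted and `2 *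
des π + 1 = π.length` (`uniquelySorted_iff`). Every nonempty suffix of a sorted word satisfies `2 *
des v + 1 ≤ v.length`. Equality for the whole word forces the cut between `s(L)` and `s(R)` at every
level of the recursion; conversely, slack anywhere yields a second preimage. (2) For words avoiding
`312`, the suffix condition is also sufficient for sortedness (`SuffixBallot.isSorted`). When the
number of descents is extremal, it is equivalent to a condition on prefixes
(`prefixBallot_iff_suffixBallot`), which suits building words from left to right. (3) Appending a
last letter to a word of `S n` ending in `x` keeps both patterns out exactly when the new letter is
`1`, `n + 1` or `x` (`avoids_insertLast_iff`). The choices `1` and `x` create a descent and coincide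
when `x = 1`; the choice `n + 1` creates an ascent. The resulting pair of recursions, for all words
and for those not ending in `1`, is the last-step recursion of walks on `ℕ` with steps `+2` and `-1`
(`ncard_ballotWords_eq_walks`). Length `2k + 1` with `k` descents corresponds to closed walks of
length `3k`, counted by a ballot formula (`walks_zero_right`). -/

/-! ### Walks with steps `+2` and `-1` -/

/-- The number of walks on `ℕ` with `m` steps `+2` or `-1` from `a` to `b`. -/
def walks : ℕ → ℕ → ℕ → ℕ
  | 0, a, b => if a = b then 1 else 0
  | m + 1, 0, b => walks m 2 b
  | m + 1, a + 1, b => walks m (a + 3) b + walks m a b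

/-- The definition peels off the first step; appending a letter to a word corresponds to peeling off
the last one. -/
theorem walks_succ_last (m a b : ℕ) :
    walks (m + 1) a b = walks m a (b + 1) + if 2 ≤ b then walks m a (b - 2) else 0 := by
  induction m generalizing a with
  | zero =>
    rcases a with _ | a <;> rcases b with _ | _ | b <;> simp [walks] <;> grind
  | succ m ih =>
    cases a with
    | zero =>
      rw [walks, ih]
      simp only [walks]
    | succ a =>
      rw [walks, ih, ih]
      simp only [walks]
      split_ifs <;> omega

theorem walks_zero_right_eq_zero {m a : ℕ} (h : m < a) : walks m a 0 = 0 := by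
  induction m generalizing a with
  | zero => simp [walks]; omega
  | succ m ih =>
    obtain ⟨a, rfl⟩ : ∃ b, a = b + 1 := ⟨a - 1, by omega⟩
    simp [walks, ih (a := a + 3) (by omega), ih (a := a) (by omega)]

/-- A ballot formula: `r` is the number of `+2` steps, forced by the endpoints. Fixing the endpoint
`0` and varying the start makes the first-step recursion close up. -/
theorem walks_zero_right (m a r : ℕ) (h : m = a + 3 * r) :
    (walks m a 0 : ℚ) * (m + 1) = (a + 1) * (m + 1).choose r := by
  induction m generalizing a r with
  | zero =>
    obtain rfl : a = 0 := by omega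
    obtain rfl : r = 0 := by omega
    simp [walks]
  | succ m ih =>
    have pascal : ∀ q : ℕ, q ≤ m + 1 → ((m + 1).choose q : ℚ) * (m + 2) =
        (m + 2).choose q * (m + 2 - q) := by
      intro q hq
      have h1 := Nat.choose_mul_succ_eq (m + 1) q
      have h2 : ((m + 1 + 1 - q : ℕ) : ℚ) = m + 2 - q := by
        rw [Nat.cast_sub (by omega)]; push_cast; ring
      rw [← h2]
      exact_mod_cast h1
    have hm : (m : ℚ) + 1 ≠ 0 := by positivity
    rcases r with _ | r
    · obtain rfl : a = m + 1 := by omega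
      have h1 := ih m 0 (by omega)
      have h3 : walks m (m + 3) 0 = 0 := walks_zero_right_eq_zero (by omega)
      simp only [walks, h3, Nat.choose_zero_right, zero_add] at h1 ⊢
      have : (walks m m 0 : ℚ) = 1 := by
        apply mul_right_cancel₀ hm; push_cast at h1; linarith
      rw [this]; push_cast; ring
    · have hr : (m : ℚ) + 1 = a + 3 * (r + 1) := by exact_mod_cast h
      -- `hsucc` and `h2` express both binomials of row `m + 1` through `(m + 2).choose (r + 1)`, so
      -- only a linear identity remains.
      have hsucc : ((m + 1).choose r : ℚ) * (m + 2) = (m + 2).choose (r + 1) * (r + 1) := by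
        have := Nat.add_one_mul_choose_eq (m + 1) r
        rw [mul_comm]
        exact_mod_cast this
      have h2 := pascal (r + 1) (by omega)
      push_cast at h2
      have hm2 : (m : ℚ) + 2 ≠ 0 := by positivity
      rcases a with _ | a
      · have h1 := ih 2 r (by omega)
        simp only [walks]
        apply mul_right_cancel₀ hm
        push_cast at h1 hr ⊢
        linear_combination (m + 2) * h1 + 3 * hsucc - ((m + 2).choose (r + 1) : ℚ) * hr
      · have h1 := ih (a + 3) r (by omega)
        have h3 := ih a (r + 1) (by omega)
        simp only [walks]
        apply mul_right_cancel₀ hm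
        push_cast at h1 h3 hr ⊢
        linear_combination (m + 2) * h1 + (m + 2) * h3 + (a + 4) * hsucc + (a + 1) * h2
          - ((m + 2).choose (r + 1) : ℚ) * hr

theorem walks_three_mul (k : ℕ) :
    (walks (3 * k) 0 0 : ℚ) = 1 / (2 * (k : ℚ) + 1) * ((3 * k).choose k : ℚ) := by
  have h := walks_zero_right (3 * k) 0 k (by omega)
  have h1 := Nat.choose_mul_succ_eq (3 * k) k
  rw [show 3 * k + 1 - k = 2 * k + 1 by omega] at h1
  have h2 : ((3 * k).choose k : ℚ) * (3 * k + 1) = (3 * k + 1).choose k * (2 * k + 1) := by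
    exact_mod_cast h1
  have h3 : (3 * (k : ℚ) + 1) ≠ 0 := by positivity
  push_cast at h
  field_simp
  apply mul_right_cancel₀ h3
  linear_combination (2 * (k : ℚ) + 1) * h - h2

/-! ### Descents -/

/-- The number of descents of a word. -/
def des : List ℕ → ℕ
  | [] => 0
  | [_] => 0
  | a :: b :: l => (if b < a then 1 else 0) + des (b :: l)

@[simp] theorem des_nil : des [] = 0 := rfl

@[simp] theorem des_singleton (a : ℕ) : des [a] = 0 := rfl

theorem des_cons_cons (a b : ℕ) (l : List ℕ) :
    des (a :: b :: l) = (if b < a then 1 else 0) + des (b :: l) := rfl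

theorem des_append_cons (A : List ℕ) (x : ℕ) (B : List ℕ) :
    des (A ++ x :: B) = des (A ++ [x]) + des (x :: B) := by
  induction A with
  | nil => simp
  | cons a A ih =>
    cases A with
    | nil => simp [des_cons_cons]
    | cons b A =>
      simp only [List.cons_append, des_cons_cons] at ih ⊢
      omega

theorem des_append_pair (A : List ℕ) (x y : ℕ) :
    des (A ++ [x, y]) = des (A ++ [x]) + if y < x then 1 else 0 := by
  rw [des_append_cons]; simp [des_cons_cons]

theorem des_append_cons_cons (A : List ℕ) (x y : ℕ) (B : List ℕ) :
    des (A ++ x :: y :: B) = des (A ++ [x]) + (if y < x then 1 else 0) + des (y :: B) := by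
  rw [des_append_cons, des_cons_cons]; omega

theorem des_append_max (A : List ℕ) (m : ℕ) (h : ∀ x ∈ A, x < m) : des (A ++ [m]) = des A := by
  rcases List.eq_nil_or_concat A with rfl | ⟨A, x, rfl⟩
  · rfl
  · have := h x (by simp)
    simp only [List.concat_eq_append, List.append_assoc, List.singleton_append]
    rw [des_append_pair, if_neg (by omega)]; simp

theorem des_map (f : ℕ → ℕ) (hf : StrictMono f) (l : List ℕ) : des (l.map f) = des l := by
  induction l with
  | nil => rfl
  | cons a l ih =>
    cases l with
    | nil => rfl
    | cons b l => simp_all [des_cons_cons, hf.lt_iff_lt]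

theorem des_append_le (A B : List ℕ) (hA : A ≠ []) (hB : B ≠ []) :
    des (A ++ B) ≤ des A + des B + 1 := by
  obtain ⟨A, x, rfl⟩ := (List.eq_nil_or_concat A).resolve_left hA
  obtain ⟨y, B, rfl⟩ := List.exists_cons_of_ne_nil hB
  simp only [List.concat_eq_append, List.append_assoc, List.singleton_append]
  rw [des_append_cons_cons]
  split_ifs <;> omega

/-! ### The stack-sorting map -/

theorem stackSort_nil : stackSort [] = [] := by rw [stackSort]; simp

theorem max_append_cons (L R : List ℕ) (m : ℕ) (hL : ∀ x ∈ L, x < m) (hR : ∀ x ∈ R, x < m)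
    (h : L ++ m :: R ≠ []) : (L ++ m :: R).max h = m := by
  apply le_antisymm
  · rw [List.max_le_iff]
    intro b hb
    simp only [List.mem_append, List.mem_cons] at hb
    rcases hb with hb | rfl | hb
    · exact (hL b hb).le
    · exact le_rfl
    · exact (hR b hb).le
  · exact List.le_max_of_mem (by simp)

theorem stackSort_append_cons (L R : List ℕ) (m : ℕ) (hL : ∀ x ∈ L, x < m)
    (hR : ∀ x ∈ R, x < m) :
    stackSort (L ++ m :: R) = stackSort L ++ stackSort R ++ [m] := by
  have hm : m ∉ L := fun h => (hL m h).false
  have hi : (L ++ m :: R).idxOf m = L.length := by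
    rw [List.idxOf_append_of_notMem hm]; simp
  rw [stackSort]
  rw [dif_neg (by simp), max_append_cons L R m hL hR, hi]
  simp

theorem exists_eq_append_max {σ : List ℕ} (hσ : σ.Nodup) (hne : σ ≠ []) :
    ∃ L m R, σ = L ++ m :: R ∧ (∀ x ∈ L, x < m) ∧ ∀ x ∈ R, x < m := by
  obtain ⟨L, R, h⟩ := List.append_of_mem (List.max_mem hne)
  have hle : ∀ x ∈ σ, x ≤ σ.max hne := fun x hx => List.le_max_of_mem hx
  generalize σ.max hne = m at *
  subst h
  rw [List.nodup_middle, List.nodup_cons] at hσ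
  refine ⟨L, m, R, rfl, fun x hx => lt_of_le_of_ne (hle x (by simp [hx])) ?_,
    fun x hx => lt_of_le_of_ne (hle x (by simp [hx])) ?_⟩
  · rintro rfl; exact hσ.1 (by simp [hx])
  · rintro rfl; exact hσ.1 (by simp [hx])

theorem IsPermutation.sublist {l l' : List ℕ} (h : IsPermutation l) (hs : l'.Sublist l) :
    IsPermutation l' :=
  ⟨h.1.sublist hs, fun x hx => h.2 x (hs.subset hx)⟩

theorem IsPermutation.perm {l l' : List ℕ} (h : IsPermutation l) (hs : l'.Perm l) :
    IsPermutation l' :=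
  ⟨hs.nodup_iff.2 h.1, fun x hx => h.2 x (hs.subset hx)⟩

/-- Induction along the decomposition of a word around its largest letter. -/
theorem max_induction {P : List ℕ → Prop} (nil : P [])
    (step : ∀ L m R, (∀ x ∈ L, x < m) → (∀ x ∈ R, x < m) → IsPermutation (L ++ m :: R) →
      P L → P R → P (L ++ m :: R)) (σ : List ℕ) (hσ : IsPermutation σ) : P σ := by
  induction hn : σ.length using Nat.strong_induction_on generalizing σ with
  | _ n ih =>
    by_cases hne : σ = []
    · exact hne ▸ nil
    · obtain ⟨L, m, R, rfl, hL, hR⟩ := exists_eq_append_max hσ.1 hne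
      simp only [List.length_append, List.length_cons] at hn
      exact step L m R hL hR hσ
        (ih L.length (by omega) L (hσ.sublist (by simp)) rfl)
        (ih R.length (by omega) R
          (hσ.sublist ((List.sublist_cons_self m R).trans (List.sublist_append_right _ _))) rfl)

theorem stackSort_perm {σ : List ℕ} (hσ : IsPermutation σ) : (stackSort σ).Perm σ := by
  refine max_induction (P := fun σ => (stackSort σ).Perm σ) (by rw [stackSort_nil]) ?_ σ hσ
  intro L m R hL hR _ h1 h2
  rw [stackSort_append_cons L R m hL hR]
  refine List.Perm.trans ?_ List.perm_middle.symm
  refine (List.perm_append_singleton m _).trans ?_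
  exact (h1.append h2).cons m

theorem suffix_append_iff {v A B : List ℕ} :
    v <:+ A ++ B ↔ v <:+ B ∨ ∃ u, v = u ++ B ∧ u <:+ A := by
  constructor
  · rintro ⟨t, h⟩
    rcases List.append_eq_append_iff.1 h with ⟨u, rfl, rfl⟩ | ⟨u, rfl, rfl⟩
    · exact Or.inr ⟨u, rfl, List.suffix_append _ _⟩
    · exact Or.inl (List.suffix_append _ _)
  · rintro (h | ⟨u, rfl, h⟩)
    · exact List.suffix_append_of_suffix h
    · exact List.suffix_append_self_iff.2 h

/-! ### Sorted words and the suffix condition -/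

/-- The word has at least one preimage under the stack-sorting map. -/
def IsSorted (π : List ℕ) : Prop :=
  ∃ σ, IsPermutation σ ∧ stackSort σ = π

/-- Every nonempty final segment has at least as many ascents as descents. -/
def SuffixBallot (π : List ℕ) : Prop :=
  ∀ v, v ≠ [] → v <:+ π → 2 * des v + 1 ≤ v.length

theorem IsSorted.isPermutation {π : List ℕ} (h : IsSorted π) : IsPermutation π := by
  obtain ⟨σ, hσ, rfl⟩ := h
  exact hσ.perm (stackSort_perm hσ)

theorem isSorted_nil : IsSorted [] := ⟨[], ⟨by simp, by simp⟩, stackSort_nil⟩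

/-- The junction of `A` and `B` adds at most one descent, and the two units of length it requires
come from the final `m` and from merging two `+ 1` terms into one. -/
theorem SuffixBallot.append {A B : List ℕ} {m : ℕ} (hA : SuffixBallot A) (hB : SuffixBallot B)
    (hAm : ∀ x ∈ A, x < m) (hBm : ∀ x ∈ B, x < m) : SuffixBallot (A ++ B ++ [m]) := by
  intro v hv hs
  obtain ⟨v', rfl, hs'⟩ : ∃ v', v = v' ++ [m] ∧ v' <:+ A ++ B := by
    rcases List.suffix_concat_iff.1 hs with rfl | ⟨v', rfl, h⟩
    · exact absurd rfl hv
    · exact ⟨v', rfl, h⟩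
  have hlt : ∀ x ∈ v', x < m := fun x hx => by
    rcases List.mem_append.1 (hs'.subset hx) with h | h
    exacts [hAm x h, hBm x h]
  rw [des_append_max _ _ hlt]
  simp only [List.length_append, List.length_singleton]
  rcases suffix_append_iff.1 hs' with h | ⟨A', rfl, h⟩
  · by_cases h0 : v' = []
    · simp [h0]
    · have := hB v' h0 h; omega
  · by_cases hA0 : A' = []
    · subst hA0
      by_cases h0 : B = []
      · simp [h0]
      · have := hB B h0 (List.suffix_refl _)
        simp; omega
    · have h1 := hA A' hA0 h
      by_cases h0 : B = []
      · simp [h0]; omega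
      · have h2 := hB B h0 (List.suffix_refl _)
        have h3 := des_append_le A' B hA0 h0
        simp only [List.length_append]; omega

theorem IsSorted.suffixBallot {π : List ℕ} (h : IsSorted π) : SuffixBallot π := by
  obtain ⟨σ, hσ, rfl⟩ := h
  refine max_induction (P := fun σ => SuffixBallot (stackSort σ)) ?_ ?_ σ hσ
  · rw [stackSort_nil]
    intro v hv h
    exact absurd (List.suffix_nil.1 h) hv
  · intro L m R hL hR hp h1 h2
    have hLp : IsPermutation L := hp.sublist (by simp)
    have hRp : IsPermutation R :=
      hp.sublist ((List.sublist_cons_self m R).trans (List.sublist_append_right _ _))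
    rw [stackSort_append_cons L R m hL hR]
    exact h1.append h2 (fun x hx => hL x ((stackSort_perm hLp).subset hx))
      (fun x hx => hR x ((stackSort_perm hRp).subset hx))

theorem IsPermutation.perm_append_singleton {L R A B : List ℕ} {m : ℕ}
    (h : IsPermutation (A ++ B ++ [m])) (hL : A.Perm L) (hR : B.Perm R) :
    IsPermutation (L ++ m :: R) := by
  refine h.perm (List.Perm.trans List.perm_middle ?_)
  exact List.Perm.trans ((hL.append hR).symm.cons m) (List.perm_append_singleton m _).symm

theorem stackSort_eq_join {L R A B : List ℕ} {m : ℕ} (hL : IsPermutation L)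
    (hR : IsPermutation R) (hLA : stackSort L = A) (hRB : stackSort R = B)
    (hA : ∀ x ∈ A, x < m) (hB : ∀ x ∈ B, x < m) (hp : IsPermutation (A ++ B ++ [m])) :
    IsPermutation (L ++ m :: R) ∧ stackSort (L ++ m :: R) = A ++ B ++ [m] := by
  subst hLA hRB
  have pL := stackSort_perm hL
  have pR := stackSort_perm hR
  exact ⟨hp.perm_append_singleton pL pR, stackSort_append_cons L R m
    (fun x hx => hA x (pL.symm.subset hx)) (fun x hx => hB x (pR.symm.subset hx))⟩

theorem IsSorted.join {A B : List ℕ} {m : ℕ} (hA : IsSorted A) (hB : IsSorted B)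
    (hAm : ∀ x ∈ A, x < m) (hBm : ∀ x ∈ B, x < m) (hp : IsPermutation (A ++ B ++ [m])) :
    IsSorted (A ++ B ++ [m]) := by
  obtain ⟨L, hL, hLA⟩ := hA
  obtain ⟨R, hR, hRB⟩ := hB
  exact ⟨_, stackSort_eq_join hL hR hLA hRB hAm hBm hp⟩

theorem preimage_cases {σ π : List ℕ} (hσ : IsPermutation σ) (h : stackSort σ = π)
    (hne : π ≠ []) :
    ∃ L m R, σ = L ++ m :: R ∧ π = stackSort L ++ stackSort R ++ [m] ∧
      IsPermutation L ∧ IsPermutation R ∧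
      (∀ x ∈ stackSort L, x < m) ∧ (∀ x ∈ stackSort R, x < m) := by
  have hσ0 : σ ≠ [] := by
    rintro rfl
    exact hne (h ▸ stackSort_nil)
  obtain ⟨L, m, R, rfl, hL, hR⟩ := exists_eq_append_max hσ.1 hσ0
  have hLp : IsPermutation L := hσ.sublist (by simp)
  have hRp : IsPermutation R :=
    hσ.sublist ((List.sublist_cons_self m R).trans (List.sublist_append_right _ _))
  refine ⟨L, m, R, rfl, ?_, hLp, hRp, fun x hx => hL x ((stackSort_perm hLp).subset hx),
    fun x hx => hR x ((stackSort_perm hRp).subset hx)⟩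
  rw [← h, stackSort_append_cons L R m hL hR]

theorem IsSorted.exists_join {π : List ℕ} (h : IsSorted π) (hne : π ≠ []) :
    ∃ A B m, π = A ++ B ++ [m] ∧ IsSorted A ∧ IsSorted B ∧
      (∀ x ∈ A, x < m) ∧ (∀ x ∈ B, x < m) := by
  obtain ⟨σ, hσ, hs⟩ := h
  obtain ⟨L, m, R, -, h1, hL, hR, h2, h3⟩ := preimage_cases hσ hs hne
  exact ⟨_, _, m, h1, ⟨L, hL, rfl⟩, ⟨R, hR, rfl⟩, h2, h3⟩

theorem IsSorted.lt_last {A : List ℕ} {x : ℕ} (h : IsSorted (A ++ [x])) : ∀ y ∈ A, y < x := by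
  obtain ⟨A', B', m, he, -, -, h1, h2⟩ := h.exists_join (by simp)
  obtain ⟨rfl, hm⟩ := List.append_inj' he rfl
  obtain rfl : x = m := by simpa using hm
  intro y hy
  rcases List.mem_append.1 hy with hy | hy
  exacts [h1 y hy, h2 y hy]

/-- Write `y :: B` as `C ++ D ++ [m]` with `C`, `D` sorted. By induction `A ++ [x]` can be glued to
the front of `C`, or of `D` if `C` is empty, and `m` is then restored as the maximum. -/
theorem IsSorted.append {A B : List ℕ} {x y : ℕ} (hA : IsSorted (A ++ [x]))
    (hB : IsSorted (y :: B)) (hxy : x < y) (hp : IsPermutation (A ++ [x] ++ y :: B)) :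
    IsSorted (A ++ [x] ++ y :: B) := by
  induction hn : B.length using Nat.strong_induction_on generalizing B with
  | _ n ih =>
    obtain ⟨C, D, m, he, hC, hD, hCm, hDm⟩ := hB.exists_join (by simp)
    have hAy : ∀ z ∈ A ++ [x], z < y := by
      intro z hz
      rcases List.mem_append.1 hz with hz | hz
      · exact (hA.lt_last z hz).trans hxy
      · rw [List.mem_singleton.1 hz]; exact hxy
    have hlen : B.length = C.length + D.length := by
      have := congrArg List.length he
      simp at this; omega
    rcases C with _ | ⟨c, C⟩
    · rcases D with _ | ⟨d, D⟩
      · obtain ⟨rfl, rfl⟩ : y = m ∧ B = [] := by simpa using he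
        have := hA.join isSorted_nil hAy (by simp) (by simpa using hp)
        simpa using this
      · obtain ⟨rfl, rfl⟩ : y = d ∧ B = D ++ [m] := by simpa using he
        have hym : y < m := hDm y (by simp)
        have h1 := ih D.length (by simp at hn; omega) hD
          (hp.sublist (by simp)) rfl
        have := h1.join isSorted_nil (m := m) (fun z hz => by
          rcases List.mem_append.1 hz with hz | hz
          · exact (hAy z hz).trans hym
          · exact hDm z hz) (by simp) (by simpa using hp)
        simpa using this
    · obtain ⟨rfl, rfl⟩ : y = c ∧ B = C ++ D ++ [m] := by simpa using he
      have hym : y < m := hCm y (by simp)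
      have h1 := ih C.length (by simp at hn; omega) hC
          (hp.sublist (by simp)) rfl
      have := h1.join hD (m := m) (fun z hz => by
        rcases List.mem_append.1 hz with hz | hz
        · exact (hAy z hz).trans hym
        · exact hCm z hz) hDm (by simpa using hp)
      simpa using this

/-! ### Unique sortedness and the number of descents -/

theorem uniquelySorted_iff_existsUnique {π : List ℕ} :
    UniquelySorted π ↔ ∃! σ, IsPermutation σ ∧ stackSort σ = π := by
  rw [UniquelySorted, fertility, Set.ncard_eq_one]
  constructor
  · rintro ⟨a, ha⟩
    exact ⟨a, (Set.ext_iff.1 ha a).2 rfl, fun b hb => (Set.ext_iff.1 ha b).1 hb⟩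
  · rintro ⟨a, ha, hu⟩
    exact ⟨a, Set.ext fun b => ⟨fun hb => hu b hb, by rintro rfl; exact ha⟩⟩

theorem UniquelySorted.isSorted {π : List ℕ} (h : UniquelySorted π) : IsSorted π :=
  (uniquelySorted_iff_existsUnique.1 h).exists

theorem UniquelySorted.two_mul_des_add_one {π : List ℕ} (h : UniquelySorted π) (hne : π ≠ []) :
    2 * des π + 1 = π.length := by
  induction hn : π.length using Nat.strong_induction_on generalizing π with
  | _ n ih =>
    obtain ⟨σ, ⟨hσ, hs⟩, hu⟩ := uniquelySorted_iff_existsUnique.1 h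
    have hp : IsPermutation π := h.isSorted.isPermutation
    obtain ⟨L, m, R, rfl, rfl, hL, hR, hLm, hRm⟩ := preimage_cases hσ hs hne
    have hlt : ∀ z ∈ stackSort L ++ stackSort R, z < m := by
      intro z hz
      rcases List.mem_append.1 hz with hz | hz
      exacts [hLm z hz, hRm z hz]
    -- Recutting the word before `m` into two sorted pieces gives another preimage, so uniqueness
    -- forbids it.
    have key : ∀ L' R', IsPermutation L' → IsPermutation R' →
        stackSort L' ++ stackSort R' = stackSort L ++ stackSort R → L' = L ∧ R' = R := by
      intro L' R' hL' hR' he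
      have h1 := hu (L' ++ m :: R') (by
        rw [← he]
        rw [← he] at hp hlt
        exact stackSort_eq_join hL' hR' rfl rfl (fun x hx => hlt x (by simp [hx]))
          (fun x hx => hlt x (by simp [hx])) hp)
      have hm : ∀ {X Y : List ℕ}, IsPermutation X → IsPermutation Y →
          stackSort X ++ stackSort Y = stackSort L ++ stackSort R → m ∉ X := by
        intro X Y hX hY e hmX
        have : m ∈ stackSort X := (stackSort_perm hX).symm.subset hmX
        exact (hlt m (e ▸ by simp [this])).false
      have hm1 := hm hL' hR' he
      have hm2 := hm hL hR rfl
      have hi := congrArg (List.idxOf m) h1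
      rw [List.idxOf_append_of_notMem hm1, List.idxOf_append_of_notMem hm2] at hi
      simp at hi
      have := List.append_inj h1 hi
      exact ⟨this.1, by simpa using this.2⟩
    rw [des_append_max _ _ hlt]
    simp only [List.length_append, List.length_singleton] at hn ⊢
    have nilp : IsPermutation [] := ⟨by simp, by simp⟩
    by_cases hL0 : L = []
    -- With nothing to the left of `m`, moving `R` there would give a second preimage, so `R` is
    -- empty too.
    · subst hL0
      have := key R [] hR nilp (by simp [stackSort_nil])
      rw [← this.2]
      rw [← this.2] at hn
      simp [stackSort_nil] at hn ⊢
      omega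
    by_cases hR0 : R = []
    · exact absurd (key [] L nilp hL (by simp [hR0, stackSort_nil])).1.symm hL0
    have hLl := (stackSort_perm hL).length_eq
    have hRl := (stackSort_perm hR).length_eq
    have hL1 : 0 < L.length := List.length_pos_iff.2 hL0
    have hR1 : 0 < R.length := List.length_pos_iff.2 hR0
    have uL : UniquelySorted (stackSort L) := uniquelySorted_iff_existsUnique.2
      ⟨L, ⟨hL, rfl⟩, fun L' hL' => (key L' R hL'.1 hR (by rw [hL'.2])).1⟩
    have uR : UniquelySorted (stackSort R) := uniquelySorted_iff_existsUnique.2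
      ⟨R, ⟨hR, rfl⟩, fun R' hR' => (key L R' hL hR'.1 (by rw [hR'.2])).2⟩
    have hLne : stackSort L ≠ [] := fun h => by simp [h] at hLl; omega
    have hRne : stackSort R ≠ [] := fun h => by simp [h] at hRl; omega
    have dL := ih _ (by omega) uL hLne rfl
    have dR := ih _ (by omega) uR hRne rfl
    obtain ⟨A, x, hA⟩ := (List.eq_nil_or_concat _).resolve_left hLne
    obtain ⟨y, B, hB⟩ := List.exists_cons_of_ne_nil hRne
    rw [List.concat_eq_append] at hA
    have hsL : IsSorted (A ++ [x]) := hA ▸ ⟨L, hL, rfl⟩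
    have hsR : IsSorted (y :: B) := hB ▸ ⟨R, hR, rfl⟩
    rw [hA] at dL
    rw [hB] at dR
    rw [hA, hB] at hp hn key ⊢
    have hp' : IsPermutation (A ++ [x] ++ y :: B) := hp.sublist (by simp)
    -- At an ascent `s(L) s(R)` would itself be sorted, say `s(τ)`, and `τ m` would be a second
    -- preimage.
    have hyx : y < x := by
      by_contra hcon
      have hne' : x ≠ y := by
        rintro rfl
        have := hp'.1
        simp [List.nodup_append] at this
      obtain ⟨τ, hτ, hτs⟩ := hsL.append hsR (by omega) hp'
      exact hR0 (key τ [] hτ nilp (by simp [stackSort_nil, hτs])).2.symm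
    rw [List.append_assoc, List.singleton_append, des_append_cons_cons, if_pos hyx]
    omega

/-- By `hd` there is a descent where `A'` meets `B'`. If the cut of `A`, `B` comes earlier, `B` has
as suffix the last letter of `A'` followed by `B'`; as `B'` is tight, that suffix has one descent
too many. -/
theorem join_eq_of_length_lt {A B A' B' : List ℕ} (he : A ++ B = A' ++ B')
    (hlt : A.length < A'.length) (hB : SuffixBallot B) (hB' : 2 * des B' + 1 = B'.length)
    (hd : des (A' ++ B') = des A' + des B' + 1) : False := by
  rcases List.append_eq_append_iff.1 he with ⟨C, rfl, rfl⟩ | ⟨C, rfl, rfl⟩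
  · have hC : C ≠ [] := by rintro rfl; simp at hlt
    obtain ⟨C, x, rfl⟩ := (List.eq_nil_or_concat C).resolve_left hC
    have hne : B' ≠ [] := by rintro rfl; simp at hB'
    obtain ⟨y, B', rfl⟩ := List.exists_cons_of_ne_nil hne
    simp only [List.concat_eq_append, ← List.append_assoc] at hB hd
    rw [List.append_assoc (A ++ C), List.singleton_append, des_append_cons_cons] at hd
    have h := hB (x :: y :: B') (by simp) ⟨C, by simp⟩
    rw [des_cons_cons] at h
    simp only [List.length_cons] at h hB'
    omega
  · simp at hlt

/-- Equality for the whole word makes every estimate in `SuffixBallot.append` an equality; this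
excludes exactly one of `A`, `B` being empty. -/
theorem split_of_two_mul_des {A B : List ℕ} {m : ℕ} (hA : SuffixBallot A) (hB : SuffixBallot B)
    (hAm : ∀ x ∈ A, x < m) (hBm : ∀ x ∈ B, x < m)
    (hd : 2 * des (A ++ B ++ [m]) + 1 = (A ++ B ++ [m]).length) :
    (A = [] ∧ B = []) ∨ (A ≠ [] ∧ B ≠ [] ∧ 2 * des A + 1 = A.length ∧ 2 * des B + 1 = B.length ∧
      des (A ++ B) = des A + des B + 1) := by
  rw [des_append_max _ _ (by
    intro z hz
    rcases List.mem_append.1 hz with hz | hz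
    exacts [hAm z hz, hBm z hz])] at hd
  simp only [List.length_append, List.length_singleton] at hd
  by_cases hA0 : A = []
  · subst hA0
    by_cases hB0 : B = []
    · exact Or.inl ⟨rfl, hB0⟩
    · have := hB B hB0 (List.suffix_refl _)
      simp at hd; omega
  · have h1 := hA A hA0 (List.suffix_refl _)
    by_cases hB0 : B = []
    · subst hB0
      simp at hd; omega
    · have h2 := hB B hB0 (List.suffix_refl _)
      have h3 := des_append_le A B hA0 hB0
      exact Or.inr ⟨hA0, hB0, by omega, by omega, by omega⟩

theorem eq_of_stackSort_eq {σ τ : List ℕ} (hσ : IsPermutation σ) (hτ : IsPermutation τ)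
    (h : stackSort τ = stackSort σ) (hd : 2 * des (stackSort σ) + 1 = (stackSort σ).length) :
    σ = τ := by
  induction hn : σ.length using Nat.strong_induction_on generalizing σ τ with
  | _ n ih =>
    have hne : stackSort σ ≠ [] := by intro h; simp [h] at hd
    obtain ⟨L, m, R, rfl, e, hL, hR, hLm, hRm⟩ := preimage_cases hσ rfl hne
    obtain ⟨L', m', R', rfl, e', hL', hR', hLm', hRm'⟩ := preimage_cases hτ h hne
    have sb : ∀ {X}, IsPermutation X → SuffixBallot (stackSort X) :=
      fun hX => IsSorted.suffixBallot ⟨_, hX, rfl⟩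
    obtain ⟨e1, e2⟩ := List.append_inj' (e.symm.trans e') rfl
    obtain rfl : m = m' := by simpa using e2
    have c := split_of_two_mul_des (sb hL) (sb hR) hLm hRm (e ▸ hd)
    have c' := split_of_two_mul_des (sb hL') (sb hR') hLm' hRm' (e' ▸ hd)
    have nil : ∀ {X}, IsPermutation X → stackSort X = [] → X = [] := by
      intro X hX h0
      have := (stackSort_perm hX).length_eq
      rw [h0] at this
      exact List.length_eq_zero_iff.1 this.symm
    rcases c with ⟨c1, c2⟩ | ⟨c1, c2, c3, c4, c5⟩
    · rw [c1, c2] at e1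
      obtain ⟨d1, d2⟩ := List.append_eq_nil_iff.1 e1.symm
      rw [nil hL c1, nil hR c2, nil hL' d1, nil hR' d2]
    · rcases c' with ⟨d1, d2⟩ | ⟨d1, d2, d3, d4, d5⟩
      · rw [d1, d2] at e1
        exact absurd (List.append_eq_nil_iff.1 e1).1 c1
      · have hlen : (stackSort L).length = (stackSort L').length := by
          rcases lt_trichotomy (stackSort L).length (stackSort L').length with hl | hl | hl
          · exact (join_eq_of_length_lt e1 hl (sb hR) d4 d5).elim
          · exact hl
          · exact (join_eq_of_length_lt e1.symm hl (sb hR') c4 c5).elim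
        obtain ⟨f1, f2⟩ := List.append_inj e1 hlen
        simp only [List.length_append, List.length_cons] at hn
        rw [ih L.length (by omega) hL hL' f1.symm c3 rfl,
          ih R.length (by omega) hR hR' f2.symm c4 rfl]

theorem uniquelySorted_iff {π : List ℕ} (hne : π ≠ []) :
    UniquelySorted π ↔ IsSorted π ∧ 2 * des π + 1 = π.length := by
  refine ⟨fun h => ⟨h.isSorted, h.two_mul_des_add_one hne⟩, ?_⟩
  rintro ⟨⟨σ, hσ, rfl⟩, hd⟩
  exact uniquelySorted_iff_existsUnique.2
    ⟨σ, ⟨hσ, rfl⟩, fun τ hτ => (eq_of_stackSort_eq hσ hτ.1 hτ.2 hd).symm⟩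

/-! ### Pattern avoidance, and sortedness of `312`-avoiding words -/

/-- Elementwise form of avoiding `312`. -/
def Avoids312 (π : List ℕ) : Prop :=
  ∀ a b c, [a, b, c].Sublist π → ¬(b < c ∧ c < a)

/-- Elementwise form of avoiding `1342`. -/
def Avoids1342 (π : List ℕ) : Prop :=
  ∀ a b c d, [a, b, c, d].Sublist π → ¬(a < d ∧ d < b ∧ b < c)

theorem avoids_312_iff (π : List ℕ) : Avoids π [3, 1, 2] ↔ Avoids312 π := by
  have key : ∀ a b c : ℕ, SameRelativeOrder [a, b, c] [3, 1, 2] ↔ b < c ∧ c < a := by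
    intro a b c
    have h : normalization [3, 1, 2] = [3, 1, 2] := by decide
    rw [SameRelativeOrder, h]
    simp only [normalization, List.map_cons, List.map_nil, List.countP_cons, List.countP_nil,
      decide_eq_true_eq, List.cons.injEq, and_true]
    constructor
    · rintro ⟨h1, h2, h3⟩
      split_ifs at h1 h2 h3 <;> omega
    · rintro ⟨h1, h2⟩
      simp [h1.le, h2.le, h1.not_ge, h2.not_ge, (h1.trans h2).le, (h1.trans h2).not_ge]
  constructor
  · intro h a b c hs hc
    exact h ⟨_, hs, (key a b c).2 hc⟩
  · rintro h ⟨ρ, hs, hρ⟩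
    have hl : ρ.length = 3 := by simpa [normalization] using congrArg List.length hρ
    obtain ⟨a, b, c, rfl⟩ := List.length_eq_three.1 hl
    exact h a b c hs ((key a b c).1 hρ)

theorem avoids_1342_iff (π : List ℕ) : Avoids π [1, 3, 4, 2] ↔ Avoids1342 π := by
  have key : ∀ a b c d : ℕ, SameRelativeOrder [a, b, c, d] [1, 3, 4, 2] ↔
      a < d ∧ d < b ∧ b < c := by
    intro a b c d
    have h : normalization [1, 3, 4, 2] = [1, 3, 4, 2] := by decide
    rw [SameRelativeOrder, h]
    simp only [normalization, List.map_cons, List.map_nil, List.countP_cons, List.countP_nil,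
      decide_eq_true_eq, List.cons.injEq, and_true]
    constructor
    · rintro ⟨h1, h2, h3, h4⟩
      have e1 : a < b ∧ a < c ∧ a < d := by
        clear h2 h3 h4; split_ifs at h1 <;> omega
      have e3 : b ≤ c ∧ d ≤ c := by
        clear h1 h2 h4; split_ifs at h3 <;> omega
      have e4 : d < b := by
        clear h1 h2 h3; split_ifs at h4 <;> omega
      have e2 : b < c := by
        clear h1 h3 h4; split_ifs at h2 <;> omega
      exact ⟨e1.2.2, e4, e2⟩
    · rintro ⟨h1, h2, h3⟩
      have h4 := h1.trans h2
      have h5 := h2.trans h3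
      have h6 := h1.trans h5
      simp [h1.le, h2.le, h3.le, h4.le, h5.le, h6.le, h1.not_ge, h2.not_ge, h3.not_ge,
        h4.not_ge, h5.not_ge, h6.not_ge]
  constructor
  · intro h a b c d hs hc
    exact h ⟨_, hs, (key a b c d).2 hc⟩
  · rintro h ⟨ρ, hs, hρ⟩
    have hl : ρ.length = 4 := by simpa [normalization] using congrArg List.length hρ
    match ρ, hl with
    | [a, b, c, d], _ => exact h a b c d hs ((key a b c d).1 hρ)

theorem Avoids312.sublist {l l' : List ℕ} (h : Avoids312 l) (hs : l'.Sublist l) : Avoids312 l' :=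
  fun a b c habc => h a b c (habc.trans hs)

theorem lt_of_avoids312 {A : List ℕ} {x m : ℕ} (hp : IsPermutation (A ++ [x] ++ [m]))
    (h : Avoids312 (A ++ [x] ++ [m])) (hxm : x < m) : ∀ y ∈ A ++ [x], y < m := by
  intro y hy
  rcases List.mem_append.1 hy with hy | hy
  · by_contra hcon
    have hne : y ≠ m := by
      rintro rfl
      have := hp.1
      simp [List.nodup_append] at this
      exact (this.2.2 y hy).2 rfl
    refine h y x m ?_ ⟨hxm, by omega⟩
    simpa using ((List.singleton_sublist.2 hy).append (List.Sublist.refl [x])).append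
      (List.Sublist.refl [m])
  · rw [List.mem_singleton.1 hy]; exact hxm

/-- A word whose final segments are not all ballot has a shortest bad one. -/
theorem exists_split_of_not_suffixBallot {ρ : List ℕ} (h : ¬SuffixBallot ρ) :
    ∃ A x y B, ρ = A ++ [x] ++ y :: B ∧ y < x ∧ SuffixBallot (y :: B) ∧
      2 * des (y :: B) + 1 = (y :: B).length := by
  induction ρ with
  | nil => exact absurd (fun v hv hs => absurd (List.suffix_nil.1 hs) hv) h
  | cons a ρ ih =>
    by_cases hρ : SuffixBallot ρ
    · have hbad : ¬ 2 * des (a :: ρ) + 1 ≤ (a :: ρ).length := by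
        intro hc
        refine h fun v hv hs => ?_
        rcases List.suffix_cons_iff.1 hs with rfl | hs
        exacts [hc, hρ v hv hs]
      rcases ρ with _ | ⟨y, B⟩
      · simp at hbad
      · have h1 := hρ (y :: B) (by simp) (List.suffix_refl _)
        rw [des_cons_cons] at hbad
        simp only [List.length_cons] at hbad h1
        by_cases hya : y < a
        · rw [if_pos hya] at hbad
          exact ⟨[], a, y, B, by simp, hya, hρ, by simp only [List.length_cons]; omega⟩
        · rw [if_neg hya] at hbad; omega
    · obtain ⟨A, x, y, B, rfl, h1⟩ := ih hρ
      exact ⟨a :: A, x, y, B, by simp, h1⟩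

/-- The suffix of length two forces a final ascent, so by `312`-avoidance the last letter `m` is the
maximum. If the rest `ρ` is suffix-ballot, it is sorted by induction and goes wholly to the left of
`m`. Otherwise `ρ` is cut right after the first letter of its shortest bad suffix: the right part is
tight, the cut is a descent, and both parts inherit the suffix condition. -/
theorem SuffixBallot.isSorted {π : List ℕ} (h : SuffixBallot π) (hp : IsPermutation π)
    (ha : Avoids312 π) : IsSorted π := by
  induction hn : π.length using Nat.strong_induction_on generalizing π with
  | _ n ih =>
    rcases List.eq_nil_or_concat π with rfl | ⟨ρ, m, hπ⟩
    · exact isSorted_nil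
    rw [List.concat_eq_append] at hπ
    subst hπ
    have hlt : ∀ y ∈ ρ, y < m := by
      rcases List.eq_nil_or_concat ρ with rfl | ⟨A, x, hρ⟩
      · simp
      rw [List.concat_eq_append] at hρ
      subst hρ
      refine lt_of_avoids312 hp ha ?_
      have h1 := h [x, m] (by simp) ⟨A, by simp⟩
      have hne : x ≠ m := by
        rintro rfl
        have := hp.1
        simp [List.nodup_append] at this
      simp only [des_cons_cons, List.length_cons, List.length_nil, des_singleton] at h1
      split_ifs at h1 <;> omega
    simp only [List.length_append, List.length_singleton] at hn
    by_cases hρ : SuffixBallot ρ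
    · have h1 := ih ρ.length (by omega) hρ (hp.sublist (by simp)) (ha.sublist (by simp)) rfl
      simpa using h1.join isSorted_nil hlt (by simp) (by simpa using hp)
    · obtain ⟨A, x, y, B, rfl, hyx, hB, hBd⟩ := exists_split_of_not_suffixBallot hρ
      simp only [List.length_append, List.length_cons, List.length_nil] at hn hBd
      have sB : (y :: B).Sublist (A ++ [x] ++ y :: B ++ [m]) :=
        (List.sublist_append_right _ _).trans (List.sublist_append_left _ _)
      have sA : (A ++ [x]).Sublist (A ++ [x] ++ y :: B ++ [m]) :=
        (List.sublist_append_left _ _).trans (List.sublist_append_left _ _)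
      refine IsSorted.join (ih (A ++ [x]).length (by simp; omega) ?_ (hp.sublist sA)
          (ha.sublist sA) rfl)
        (ih (y :: B).length (by simp; omega) hB (hp.sublist sB) (ha.sublist sB) rfl)
        (fun z hz => hlt z (List.mem_append_left _ hz))
        (fun z hz => hlt z (List.mem_append_right _ hz)) hp
      intro v hv hs
      -- The condition for `v` followed by `y :: B` and `m` gives the one for `v`: the descent at
      -- the cut uses up exactly the slack left by `m` and the tight `y :: B`.
      have hs' : v ++ (y :: B ++ [m]) <:+ A ++ [x] ++ y :: B ++ [m] := by
        rw [List.append_assoc (A ++ [x])]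
        exact List.suffix_append_self_iff.2 hs
      have h1 := h _ (by simp) hs'
      rcases List.suffix_concat_iff.1 hs with rfl | ⟨v', rfl, -⟩
      · exact absurd rfl hv
      rw [List.append_assoc, List.singleton_append, List.cons_append, des_append_cons_cons,
        if_pos hyx, ← List.cons_append, des_append_max (y :: B) m
          (fun z hz => hlt z (List.mem_append_right _ hz))] at h1
      simp only [List.length_append, List.length_cons, List.length_nil] at h1 ⊢
      omega

/-! ### From suffixes to prefixes -/

/-- Every initial segment has at most one more letter than twice its number of descents. -/
def PrefixBallot (π : List ℕ) : Prop :=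
  ∀ i ≤ π.length, i ≤ 2 * des (π.take i) + 1

theorem prefixBallot_iff_suffixBallot {π : List ℕ} (h : 2 * des π + 1 = π.length) :
    PrefixBallot π ↔ SuffixBallot π := by
  -- Prefix and suffix share the letter `x`, so their descents add up to `des π` and their lengths
  -- to `π.length + 1`.
  have key : ∀ A x B, π = A ++ x :: B →
      (A.length + 1 ≤ 2 * des (A ++ [x]) + 1 ↔ 2 * des (x :: B) + 1 ≤ (x :: B).length) := by
    rintro A x B rfl
    rw [des_append_cons] at h
    simp only [List.length_append, List.length_cons] at h ⊢
    omega
  constructor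
  · rintro hπ v hv ⟨A, rfl⟩
    obtain ⟨x, B, rfl⟩ := List.exists_cons_of_ne_nil hv
    refine (key A x B rfl).1 ?_
    have := hπ (A.length + 1) (by simp)
    simpa [List.take_append, List.take_of_length_le (Nat.le_succ A.length)] using this
  · intro hπ i hi
    rcases i with _ | i
    · simp
    have hi' : i < π.length := hi
    have hd : π = π.take i ++ π[i] :: π.drop (i + 1) := by simp
    have := (key _ _ _ hd).2 (hπ _ (List.cons_ne_nil _ _) ⟨π.take i, hd.symm⟩)
    rw [List.length_take, min_eq_left (by omega)] at this
    simpa using this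

/-- Words of `S n` avoiding `312` and `1342` whose initial segments are ballot, with `d` descents. -/
def ballotWords (n d : ℕ) : Set (List ℕ) :=
  {π | π ∈ S n ∧ (Avoids312 π ∧ Avoids1342 π) ∧ PrefixBallot π ∧ des π = d}

theorem length_of_mem_S {n : ℕ} {π : List ℕ} (h : π ∈ S n) : π.length = n := by
  have h1 : π.toFinset = Finset.Icc 1 n := by
    ext x; simp [h.2 x]
  rw [← List.toFinset_card_of_nodup h.1, h1]; simp

theorem U_eq_ballotWords (k : ℕ) :
    U (2 * k + 1) {[3, 1, 2], [1, 3, 4, 2]} = ballotWords (2 * k + 1) k := by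
  ext π
  simp only [U, ballotWords, Set.mem_ofPred_eq, Set.mem_insert_iff, Set.mem_singleton_iff,
    forall_eq_or_imp, forall_eq, avoids_312_iff, avoids_1342_iff]
  refine and_congr_right fun hπ => ?_
  have hl := length_of_mem_S hπ
  have hne : π ≠ [] := by rintro rfl; simp at hl
  have hp : IsPermutation π := ⟨hπ.1, fun x hx => ((hπ.2 x).1 hx).1⟩
  rw [uniquelySorted_iff hne]
  constructor
  · rintro ⟨⟨h1, h2⟩, h3⟩
    exact ⟨h3, (prefixBallot_iff_suffixBallot h2).2 h1.suffixBallot, by omega⟩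
  · rintro ⟨h1, h2, h3⟩
    have h4 : 2 * des π + 1 = π.length := by omega
    exact ⟨⟨((prefixBallot_iff_suffixBallot h4).1 h2).isSorted hp h1.1, h4⟩, h1⟩

/-! ### Appending a last letter -/

/-- Make room for the letter `v` by shifting the letters that are at least `v`. -/
def shift (v y : ℕ) : ℕ := if v ≤ y then y + 1 else y

theorem shift_strictMono (v : ℕ) : StrictMono (shift v) := by
  intro a b h
  unfold shift
  split_ifs <;> omega

theorem shift_lt_iff {v y : ℕ} : shift v y < v ↔ y < v := by
  unfold shift; split_ifs <;> omega

theorem lt_shift_iff {v y : ℕ} : v < shift v y ↔ v ≤ y := by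
  unfold shift; split_ifs <;> omega

theorem shift_ne (v y : ℕ) : shift v y ≠ v := by
  unfold shift; split_ifs <;> omega

theorem exists_shift_eq {v y : ℕ} (h : y ≠ v) : ∃ z, shift v z = y := by
  refine ⟨if v < y then y - 1 else y, ?_⟩
  unfold shift
  split_ifs <;> omega

/-- Append the letter `v` to the word `w`, shifting the letters of `w` to make room for it. -/
def insertLast (v : ℕ) (w : List ℕ) : List ℕ := w.map (shift v) ++ [v]

theorem getLast?_insertLast (v : ℕ) (w : List ℕ) : (insertLast v w).getLast? = some v := by
  simp [insertLast]

theorem insertLast_inj {v v' : ℕ} {w w' : List ℕ} :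
    insertLast v w = insertLast v' w' ↔ v = v' ∧ w = w' := by
  constructor
  · intro h
    obtain ⟨h1, h2⟩ := List.append_inj' h rfl
    obtain rfl : v = v' := by simpa using h2
    exact ⟨rfl, List.map_injective_iff.2 (shift_strictMono v).injective h1⟩
  · rintro ⟨rfl, rfl⟩; rfl

theorem insertLast_mem_S {n v : ℕ} {w : List ℕ} (hw : w ∈ S n) (h1 : 1 ≤ v) (h2 : v ≤ n + 1) :
    insertLast v w ∈ S (n + 1) := by
  constructor
  · rw [insertLast, ← List.concat_eq_append, List.nodup_concat]
    refine ⟨?_, hw.1.map (shift_strictMono v).injective⟩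
    intro h
    obtain ⟨y, -, hy⟩ := List.mem_map.1 h
    exact shift_ne v y hy
  · intro y
    rw [insertLast, List.mem_append, List.mem_singleton]
    by_cases hy : y = v
    · subst hy; simp; omega
    · obtain ⟨z, rfl⟩ := exists_shift_eq hy
      rw [List.mem_map_of_injective (shift_strictMono v).injective, hw.2]
      unfold shift at hy ⊢
      split_ifs at hy ⊢ <;> omega

theorem exists_eq_insertLast {n : ℕ} {π : List ℕ} (h : π ∈ S (n + 1)) :
    ∃ v w, 1 ≤ v ∧ v ≤ n + 1 ∧ w ∈ S n ∧ π = insertLast v w := by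
  have hne : π ≠ [] := by rintro rfl; simpa using length_of_mem_S h
  obtain ⟨u, v, hπ⟩ := (List.eq_nil_or_concat π).resolve_left hne
  subst hπ
  have hv := (h.2 v).1 (by simp)
  obtain ⟨hvu, hu⟩ := (List.nodup_concat ..).1 h.1
  have hmap : ∃ w : List ℕ, w.map (shift v) = u := by
    have : ∀ y ∈ u, ∃ z, shift v z = y := fun y hy =>
      exists_shift_eq (by rintro rfl; exact hvu hy)
    choose! f hf using this
    exact ⟨u.map f, by rw [List.map_map]; exact (List.map_congr_left hf).trans (List.map_id u)⟩
  obtain ⟨w, rfl⟩ := hmap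
  refine ⟨v, w, hv.1, hv.2, ⟨hu.of_map _, fun x => ?_⟩, by simp [insertLast]⟩
  have := h.2 (shift v x)
  rw [List.concat_eq_append, List.mem_append, List.mem_singleton,
    List.mem_map_of_injective (shift_strictMono v).injective] at this
  have hne := shift_ne v x
  simp only [hne, or_false] at this
  rw [this]
  unfold shift
  split_ifs <;> omega

theorem S_zero : S 0 = {[]} := by
  ext π
  constructor
  · intro h; exact List.length_eq_zero_iff.1 (length_of_mem_S h)
  · rintro rfl; exact ⟨List.nodup_nil, fun x => by simp; omega⟩

theorem S_finite (n : ℕ) : (S n).Finite := by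
  induction n with
  | zero => rw [S_zero]; exact Set.finite_singleton _
  | succ n ih =>
    refine ((Set.finite_Icc 1 (n + 1)).image2 insertLast ih).subset ?_
    intro π hπ
    obtain ⟨v, w, h1, h2, hw, rfl⟩ := exists_eq_insertLast hπ
    exact Set.mem_image2_of_mem ⟨h1, h2⟩ hw

theorem sublist_append_singleton_iff {l u : List ℕ} {c v : ℕ} :
    (l ++ [c]).Sublist (u ++ [v]) ↔ (l ++ [c]).Sublist u ∨ (c = v ∧ l.Sublist u) := by
  rw [← List.reverse_sublist, ← List.reverse_sublist (l₂ := u), ← List.reverse_sublist (l₁ := l)]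
  simp only [List.reverse_append, List.reverse_singleton, List.singleton_append]
  rw [List.sublist_cons_iff]
  simp only [List.cons.injEq]
  constructor
  · rintro (h | ⟨r, ⟨rfl, rfl⟩, h⟩)
    exacts [Or.inl h, Or.inr ⟨rfl, h⟩]
  · rintro (h | ⟨rfl, h⟩)
    exacts [Or.inl h, Or.inr ⟨_, ⟨rfl, rfl⟩, h⟩]

theorem pair_sublist_or {w : List ℕ} {y z : ℕ} (hy : y ∈ w) (hz : z ∈ w) (h : y ≠ z) :
    [y, z].Sublist w ∨ [z, y].Sublist w := by
  obtain ⟨s, t, rfl⟩ := List.append_of_mem hy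
  rcases List.mem_append.1 hz with hz | hz
  · right
    exact (List.singleton_sublist.2 hz).append (List.singleton_sublist.2 (by simp))
  · left
    have hz' : z ∈ t := by
      rcases List.mem_cons.1 hz with rfl | hz
      exacts [absurd rfl h, hz]
    exact ((List.singleton_sublist.2 hz').cons_cons y).trans (List.sublist_append_right _ _)

theorem avoids312_insertLast {v : ℕ} {w : List ℕ} :
    Avoids312 (insertLast v w) ↔
      Avoids312 w ∧ ∀ a b, [a, b].Sublist w → ¬(b < v ∧ v ≤ a) := by
  have mono : ∀ {y z : ℕ}, shift v y < shift v z ↔ y < z := (shift_strictMono v).lt_iff_lt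
  constructor
  · intro h
    constructor
    · intro a b c hs hc
      exact h (shift v a) (shift v b) (shift v c)
        ((hs.map (shift v)).trans (List.sublist_append_left _ _)) ⟨mono.2 hc.1, mono.2 hc.2⟩
    · intro a b hs hc
      exact h (shift v a) (shift v b) v ((hs.map (shift v)).append (List.Sublist.refl [v]))
        ⟨shift_lt_iff.2 hc.1, lt_shift_iff.2 hc.2⟩
  · rintro ⟨h1, h2⟩ a b c hs hc
    rcases (sublist_append_singleton_iff (l := [a, b])).1 hs with hs | ⟨rfl, hs⟩
    · obtain ⟨l, hl, he⟩ := List.sublist_map_iff.1 hs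
      match l, he with
      | [a', b', c'], he =>
        simp only [List.cons_append, List.nil_append, List.map_cons, List.map_nil,
          List.cons.injEq, and_true] at he
        obtain ⟨rfl, rfl, rfl⟩ := he
        exact h1 _ _ _ hl ⟨mono.1 hc.1, mono.1 hc.2⟩
    · obtain ⟨l, hl, he⟩ := List.sublist_map_iff.1 hs
      match l, he with
      | [a', b'], he =>
        simp only [List.map_cons, List.map_nil, List.cons.injEq, and_true] at he
        obtain ⟨rfl, rfl⟩ := he
        exact h2 _ _ hl ⟨shift_lt_iff.1 hc.1, lt_shift_iff.1 hc.2⟩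

theorem avoids1342_insertLast {v : ℕ} {w : List ℕ} :
    Avoids1342 (insertLast v w) ↔
      Avoids1342 w ∧ ∀ a b c, [a, b, c].Sublist w → ¬(a < v ∧ v ≤ b ∧ b < c) := by
  have mono : ∀ {y z : ℕ}, shift v y < shift v z ↔ y < z := (shift_strictMono v).lt_iff_lt
  constructor
  · intro h
    constructor
    · intro a b c d hs hc
      exact h (shift v a) (shift v b) (shift v c) (shift v d)
        ((hs.map (shift v)).trans (List.sublist_append_left _ _))
        ⟨mono.2 hc.1, mono.2 hc.2.1, mono.2 hc.2.2⟩
    · intro a b c hs hc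
      exact h (shift v a) (shift v b) (shift v c) v
        ((hs.map (shift v)).append (List.Sublist.refl [v]))
        ⟨shift_lt_iff.2 hc.1, lt_shift_iff.2 hc.2.1, mono.2 hc.2.2⟩
  · rintro ⟨h1, h2⟩ a b c d hs hc
    rcases (sublist_append_singleton_iff (l := [a, b, c])).1 hs with hs | ⟨rfl, hs⟩
    · obtain ⟨l, hl, he⟩ := List.sublist_map_iff.1 hs
      match l, he with
      | [a', b', c', d'], he =>
        simp only [List.cons_append, List.nil_append, List.map_cons, List.map_nil,
          List.cons.injEq, and_true] at he
        obtain ⟨rfl, rfl, rfl, rfl⟩ := he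
        exact h1 _ _ _ _ hl ⟨mono.1 hc.1, mono.1 hc.2.1, mono.1 hc.2.2⟩
    · obtain ⟨l, hl, he⟩ := List.sublist_map_iff.1 hs
      match l, he with
      | [a', b', c'], he =>
        simp only [List.map_cons, List.map_nil, List.cons.injEq, and_true] at he
        obtain ⟨rfl, rfl, rfl⟩ := he
        exact h2 _ _ _ hl ⟨shift_lt_iff.1 hc.1, lt_shift_iff.1 hc.2.1, mono.1 hc.2.2⟩

/-- If `x < v ≤ n`, then `n`, `x` and the new letter form `312`. If `1 < v < x`, the old letters `v`
and `1` precede `x`: in the order `v, 1` they form `312` with the new letter, and in the order `1,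
v` they form `1342` with `x` and the new letter. An extreme new letter cannot end either pattern. -/
theorem avoids_insertLast_iff {n v x : ℕ} {w : List ℕ} (hw : w ++ [x] ∈ S n) (h1 : 1 ≤ v)
    (h2 : v ≤ n + 1) :
    (Avoids312 (insertLast v (w ++ [x])) ∧ Avoids1342 (insertLast v (w ++ [x]))) ↔
      (Avoids312 (w ++ [x]) ∧ Avoids1342 (w ++ [x])) ∧ (v = 1 ∨ v = n + 1 ∨ v = x) := by
  rw [avoids312_insertLast, avoids1342_insertLast]
  have mem : ∀ y, 1 ≤ y → y ≤ n → y ≠ x → y ∈ w := by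
    intro y hy hyn hyx
    simpa [hyx] using (hw.2 y).2 ⟨hy, hyn⟩
  have hx := (hw.2 x).1 (by simp)
  have snoc : ∀ {l : List ℕ}, l.Sublist w → (l ++ [x]).Sublist (w ++ [x]) :=
    fun h => h.append (List.Sublist.refl _)
  constructor
  · rintro ⟨⟨a1, b1⟩, a2, b2⟩
    refine ⟨⟨a1, a2⟩, ?_⟩
    by_contra! hcon
    obtain ⟨c1, c2, c3⟩ := hcon
    rcases lt_or_gt_of_ne c3 with hvx | hvx
    · rcases pair_sublist_or (mem v h1 (by omega) c3) (mem 1 le_rfl (by omega) (by omega)) c1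
        with hs | hs
      · exact b1 v 1 (hs.trans (List.sublist_append_left _ _)) ⟨by omega, le_rfl⟩
      · exact b2 1 v x (snoc hs) ⟨by omega, le_rfl, hvx⟩
    · exact b1 n x (snoc (List.singleton_sublist.2 (mem n (by omega) le_rfl (by omega))))
        ⟨hvx, by omega⟩
  · rintro ⟨⟨a1, a2⟩, hv⟩
    have range : ∀ {l : List ℕ}, l.Sublist (w ++ [x]) → ∀ y ∈ l, 1 ≤ y ∧ y ≤ n :=
      fun h y hy => (hw.2 y).1 (h.subset hy)
    have hxw : ∀ {l : List ℕ}, l.Sublist w → x ∉ l := by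
      intro l hl hxl
      have := hw.1
      rw [← List.concat_eq_append, List.nodup_concat] at this
      exact this.1 (hl.subset hxl)
    refine ⟨⟨a1, fun a b hs hc => ?_⟩, a2, fun a b c hs hc => ?_⟩
    · have ra := range hs a (by simp)
      have rb := range hs b (by simp)
      rcases hv with rfl | rfl | rfl
      · omega
      · omega
      -- For `v = x` the old last letter sits just above the new one, so it can replace the new
      -- letter in any forbidden pattern.
      · rcases (sublist_append_singleton_iff (l := [a])).1 hs with hs | ⟨rfl, hs⟩
        · have hav : v ≠ a := by rintro rfl; exact hxw hs (by simp)
          exact a1 a b v (snoc hs) ⟨hc.1, by omega⟩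
        · omega
    · have ra := range hs a (by simp)
      have rb := range hs b (by simp)
      rcases hv with rfl | rfl | rfl
      · omega
      · omega
      · rcases (sublist_append_singleton_iff (l := [a, b])).1 hs with hs | ⟨rfl, hs⟩
        · have hbv : v ≠ b := by rintro rfl; exact hxw hs (by simp)
          exact a2 a b c v (snoc hs) ⟨hc.1, by omega, hc.2.2⟩
        · omega

theorem prefixBallot_insertLast {v : ℕ} {w : List ℕ} :
    PrefixBallot (insertLast v w) ↔
      PrefixBallot w ∧ w.length ≤ 2 * des (insertLast v w) := by
  have key : ∀ i ≤ w.length, des ((insertLast v w).take i) = des (w.take i) := by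
    intro i hi
    rw [insertLast, List.take_append_of_le_length (by simpa using hi), ← List.map_take,
      des_map _ (shift_strictMono v)]
  have hl : (insertLast v w).length = w.length + 1 := by simp [insertLast]
  constructor
  · intro h
    refine ⟨fun i hi => ?_, ?_⟩
    · rw [← key i hi]; exact h i (by omega)
    · have := h (w.length + 1) (by omega)
      rw [List.take_of_length_le (by omega)] at this
      omega
  · rintro ⟨h1, h2⟩ i hi
    by_cases hiw : i ≤ w.length
    · rw [key i hiw]; exact h1 i hiw
    · rw [List.take_of_length_le (by omega)]; omega

theorem des_insertLast (v x : ℕ) (w : List ℕ) :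
    des (insertLast v (w ++ [x])) = des (w ++ [x]) + if v ≤ x then 1 else 0 := by
  rw [insertLast, List.map_append, List.map_singleton, List.append_assoc, List.singleton_append,
    des_append_pair, ← des_map (shift v) (shift_strictMono v) (w ++ [x])]
  simp [lt_shift_iff]

theorem insertLast_mem_ballotWords {n v x d : ℕ} {w : List ℕ} (hw : w ++ [x] ∈ S n)
    (h1 : 1 ≤ v) (h2 : v ≤ n + 1) :
    insertLast v (w ++ [x]) ∈ ballotWords (n + 1) d ↔
      w ++ [x] ∈ ballotWords n (des (w ++ [x])) ∧ (v = 1 ∨ v = n + 1 ∨ v = x) ∧ n ≤ 2 * d ∧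
        (des (w ++ [x]) + if v ≤ x then 1 else 0) = d := by
  have hl := length_of_mem_S hw
  simp only [ballotWords, Set.mem_ofPred_eq, insertLast_mem_S hw h1 h2, hw,
    avoids_insertLast_iff hw h1 h2, prefixBallot_insertLast, des_insertLast, hl]
  constructor
  · rintro ⟨-, ⟨a, b⟩, ⟨c, e⟩, rfl⟩
    exact ⟨⟨trivial, a, c, trivial⟩, b, e, rfl⟩
  · rintro ⟨⟨-, a, c, -⟩, b, e, rfl⟩
    exact ⟨trivial, ⟨a, b⟩, ⟨c, e⟩, rfl⟩

/-! ### The recursion and its comparison with walks -/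

/-- The words of `ballotWords n d` that do not end in `1`. -/
def ballotWordsNe (n d : ℕ) : Set (List ℕ) :=
  {π | π ∈ ballotWords n d ∧ π.getLast? ≠ some 1}

theorem ballotWords_finite (n d : ℕ) : (ballotWords n d).Finite :=
  (S_finite n).subset fun _ h => h.1

theorem ballotWordsNe_finite (n d : ℕ) : (ballotWordsNe n d).Finite :=
  (ballotWords_finite n d).subset fun _ h => h.1

theorem exists_append_singleton_of_mem_S {n : ℕ} {w : List ℕ} (hw : w ∈ S (n + 1)) :
    ∃ u x, w = u ++ [x] ∧ 1 ≤ x ∧ x ≤ n + 1 := by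
  have hne : w ≠ [] := by rintro rfl; simpa using length_of_mem_S hw
  obtain ⟨u, x, hu⟩ := (List.eq_nil_or_concat w).resolve_left hne
  rw [List.concat_eq_append] at hu
  exact ⟨u, x, hu, (hw.2 x).1 (by simp [hu])⟩

theorem ballotWords_eq_empty {n d : ℕ} (h : 2 * d + 1 < n) : ballotWords n d = ∅ := by
  refine Set.eq_empty_of_forall_notMem fun π hπ => ?_
  have hl := length_of_mem_S hπ.1
  have := hπ.2.2.1 n hl.ge
  rw [List.take_of_length_le hl.le, hπ.2.2.2] at this
  omega

theorem ballotWords_succ {n d : ℕ} (h : n + 1 ≤ 2 * (d + 1)) :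
    ballotWords (n + 2) (d + 1) =
      ballotWordsNe (n + 2) (d + 1) ∪ insertLast 1 '' ballotWords (n + 1) d := by
  ext π
  constructor
  · intro hπ
    by_cases hlast : π.getLast? = some 1
    · right
      obtain ⟨v, w, h1, h2, hw, rfl⟩ := exists_eq_insertLast hπ.1
      rw [getLast?_insertLast] at hlast
      obtain rfl : v = 1 := by simpa using hlast
      obtain ⟨u, x, rfl, hx, -⟩ := exists_append_singleton_of_mem_S hw
      obtain ⟨a, -, -, c⟩ := (insertLast_mem_ballotWords hw h1 h2).1 hπ
      rw [if_pos hx] at c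
      rw [Nat.succ_injective c] at a
      exact ⟨_, a, rfl⟩
    · exact Or.inl ⟨hπ, hlast⟩
  · rintro (hπ | ⟨w, hw, rfl⟩)
    · exact hπ.1
    · have hd := hw.2.2.2
      obtain ⟨u, x, rfl, hx, -⟩ := exists_append_singleton_of_mem_S hw.1
      refine (insertLast_mem_ballotWords hw.1 le_rfl (by omega)).2
        ⟨hd.symm ▸ hw, Or.inl rfl, h, ?_⟩
      rw [if_pos hx, hd]

/-- The last letter is the maximum (an ascent) or repeats the previous last letter before shifting
(a descent); the latter stays different from `1` only if the shorter word does not end in `1`. The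
default `0` of `getLastD` is never used, since all words involved are nonempty. -/
theorem ballotWordsNe_succ {n d : ℕ} (h : n + 1 ≤ 2 * (d + 1)) :
    ballotWordsNe (n + 2) (d + 1) = insertLast (n + 2) '' ballotWords (n + 1) (d + 1) ∪
      (fun w => insertLast (w.getLastD 0) w) '' ballotWordsNe (n + 1) d := by
  ext π
  constructor
  · rintro ⟨hπ, hlast⟩
    obtain ⟨v, w, h1, h2, hw, rfl⟩ := exists_eq_insertLast hπ.1
    rw [getLast?_insertLast] at hlast
    have hv : v ≠ 1 := by simpa using hlast
    obtain ⟨u, x, rfl, hx, hxn⟩ := exists_append_singleton_of_mem_S hw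
    obtain ⟨a, b, -, c⟩ := (insertLast_mem_ballotWords hw h1 h2).1 hπ
    rcases b.resolve_left hv with rfl | rfl
    · rw [if_neg (by omega), add_zero] at c
      rw [c] at a
      exact Or.inl ⟨_, a, rfl⟩
    · rw [if_pos le_rfl] at c
      rw [Nat.succ_injective c] at a
      exact Or.inr ⟨_, ⟨a, by simpa using hv⟩, by simp [List.getLastD_eq_getLast?]⟩
  · rintro (⟨w, hw, rfl⟩ | ⟨w, ⟨hw, hlast⟩, rfl⟩)
    · have hd := hw.2.2.2
      obtain ⟨u, x, rfl, hx, hxn⟩ := exists_append_singleton_of_mem_S hw.1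
      refine ⟨(insertLast_mem_ballotWords hw.1 (by omega) le_rfl).2
        ⟨hd.symm ▸ hw, Or.inr (Or.inl rfl), h, ?_⟩, ?_⟩
      · rw [if_neg (by omega), hd, add_zero]
      · rw [getLast?_insertLast]; simp
    · have hd := hw.2.2.2
      obtain ⟨u, x, rfl, hx, hxn⟩ := exists_append_singleton_of_mem_S hw.1
      have hx' : (u ++ [x]).getLastD 0 = x := by simp [List.getLastD_eq_getLast?]
      have hne : x ≠ 1 := by simpa using hlast
      simp only [hx']
      refine ⟨(insertLast_mem_ballotWords hw.1 hx (by omega)).2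
        ⟨hd.symm ▸ hw, Or.inr (Or.inr rfl), h, ?_⟩, ?_⟩
      · rw [if_pos le_rfl, hd]
      · rw [getLast?_insertLast]; simpa using hne

theorem ncard_ballotWords_succ {n d : ℕ} (h : n + 1 ≤ 2 * (d + 1)) :
    (ballotWords (n + 2) (d + 1)).ncard =
      (ballotWordsNe (n + 2) (d + 1)).ncard + (ballotWords (n + 1) d).ncard := by
  rw [ballotWords_succ h, Set.ncard_union_eq ?_ (ballotWordsNe_finite _ _)
    ((ballotWords_finite _ _).image _),
    Set.ncard_image_of_injective _ fun w w' hw => (insertLast_inj.1 hw).2]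
  rw [Set.disjoint_left]
  rintro _ hπ ⟨w, -, rfl⟩
  exact hπ.2 (getLast?_insertLast 1 w)

theorem ncard_ballotWordsNe_succ {n d : ℕ} (h : n + 1 ≤ 2 * (d + 1)) :
    (ballotWordsNe (n + 2) (d + 1)).ncard =
      (ballotWords (n + 1) (d + 1)).ncard + (ballotWordsNe (n + 1) d).ncard := by
  rw [ballotWordsNe_succ h, Set.ncard_union_eq ?_ ((ballotWords_finite _ _).image _)
    ((ballotWordsNe_finite _ _).image _),
    Set.ncard_image_of_injective _ fun w w' hw => (insertLast_inj.1 hw).2,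
    Set.ncard_image_of_injective _ fun w w' hw => (insertLast_inj.1 hw).2]
  rw [Set.disjoint_left]
  rintro _ ⟨w, -, rfl⟩ ⟨w', hw', he⟩
  have h1 := (insertLast_inj.1 he).1
  obtain ⟨u, x, rfl, hx, hxn⟩ := exists_append_singleton_of_mem_S hw'.1.1
  simp [List.getLastD_eq_getLast?] at h1
  omega

theorem mem_S_one {π : List ℕ} : π ∈ S 1 ↔ π = [1] := by
  constructor
  · intro h
    obtain ⟨x, rfl⟩ := List.length_eq_one_iff.1 (length_of_mem_S h)
    have := (h.2 x).1 (by simp)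
    rw [show x = 1 by omega]
  · rintro rfl
    exact ⟨List.nodup_singleton 1, fun x => by simp; omega⟩

theorem ballotWords_one (d : ℕ) : ballotWords 1 d = if d = 0 then {[1]} else ∅ := by
  ext π
  simp only [ballotWords, Set.mem_ofPred_eq, mem_S_one]
  constructor
  · rintro ⟨rfl, -, -, rfl⟩
    simp
  · split_ifs with hd
    · rintro rfl
      refine ⟨rfl, ⟨fun a b c h => ?_, fun a b c d h => ?_⟩, fun i hi => ?_, hd.symm⟩
      · simpa using h.length_le
      · simpa using h.length_le
      · simp at hi; omega
    · rintro ⟨⟩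

theorem ballotWordsNe_one (d : ℕ) : ballotWordsNe 1 d = ∅ := by
  refine Set.eq_empty_of_forall_notMem fun π hπ => ?_
  obtain rfl := mem_S_one.1 hπ.1.1
  exact hπ.2 rfl

theorem walks_eq_zero {m a b : ℕ} (h : a + 2 * m < b) : walks m a b = 0 := by
  induction m generalizing a with
  | zero => simp [walks]; omega
  | succ m ih =>
    rcases a with _ | a
    · rw [walks, ih (by omega)]
    · rw [walks, ih (by omega), ih (by omega)]

/-- A descent contributes one step `+2` and an ascent two steps `-1`: with `d` descents and `n - d`
ascents the length is `2n - d` and the height `4d - 2n`. Words not ending in `1` correspond to walks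
one step shorter and one unit higher, hence at odd height. The inequality `n ≤ 2d` is both the
prefix condition and nonnegativity of the height. -/
theorem ncard_ballotWords_eq_walks (n d : ℕ) :
    (ballotWords (n + 1) d).ncard =
        (if d ≤ n ∧ n ≤ 2 * d then walks (2 * n - d) 0 (4 * d - 2 * n) else 0) ∧
      (ballotWordsNe (n + 1) d).ncard =
        if d < n ∧ n ≤ 2 * d then walks (2 * n - d - 1) 0 (4 * d + 1 - 2 * n) else 0 := by
  induction n generalizing d with
  | zero =>
    rw [ballotWordsNe_one, ballotWords_one]
    rcases d with _ | d <;> simp [walks]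
  | succ n ih =>
    by_cases h : n + 1 ≤ 2 * d
    · obtain ⟨d, rfl⟩ : ∃ e, d = e + 1 := ⟨d - 1, by omega⟩
      have hB : (ballotWordsNe (n + 2) (d + 1)).ncard =
          if d < n then walks (2 * n - d) 0 (4 * d + 3 - 2 * n) else 0 := by
        rw [ncard_ballotWordsNe_succ (by omega), (ih (d + 1)).1, (ih d).2]
        by_cases hd : d < n
        · rw [if_pos (by omega), if_pos hd,
            show 2 * n - d = (2 * n - d - 1) + 1 by omega, walks_succ_last,
            show 2 * n - (d + 1) = 2 * n - d - 1 by omega,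
            show 4 * (d + 1) - 2 * n = 4 * d + 3 - 2 * n + 1 by omega,
            show 4 * d + 1 - 2 * n = 4 * d + 3 - 2 * n - 2 by omega]
          congr 1
          exact if_congr (by omega) rfl rfl
        · rw [if_neg (by omega), if_neg (by omega), if_neg hd]
      constructor
      · rw [ncard_ballotWords_succ (by omega), hB, (ih d).1]
        by_cases hd : d ≤ n
        · rw [if_pos (c := d + 1 ≤ n + 1 ∧ n + 1 ≤ 2 * (d + 1)) (by omega),
            show 2 * (n + 1) - (d + 1) = (2 * n - d) + 1 by omega, walks_succ_last,
            show 4 * (d + 1) - 2 * (n + 1) + 1 = 4 * d + 3 - 2 * n by omega,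
            show 4 * (d + 1) - 2 * (n + 1) - 2 = 4 * d - 2 * n by omega]
          congr 1
          · split_ifs with hdn
            · rfl
            -- Here `d = n`, and the height `2n + 3` is out of reach in `n` steps.
            · exact (walks_eq_zero (by omega)).symm
          · exact if_congr (by omega) rfl rfl
        · rw [if_neg (by omega), if_neg (by omega), if_neg (by omega)]
      · rw [hB]
        by_cases hd : d < n
        · rw [if_pos hd, if_pos (by omega),
            show 2 * (n + 1) - (d + 1) - 1 = 2 * n - d by omega,
            show 4 * (d + 1) + 1 - 2 * (n + 1) = 4 * d + 3 - 2 * n by omega]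
        · rw [if_neg hd, if_neg (by omega)]
    · have h0 : ballotWords (n + 1 + 1) d = ∅ := ballotWords_eq_empty (by omega)
      have h1 : ballotWordsNe (n + 1 + 1) d = ∅ :=
        Set.subset_eq_empty (fun _ h => h.1) h0
      rw [h0, h1, if_neg (by omega), if_neg (by omega)]
      simp

end StackSorting

theorem corollary3 (k : ℕ) :
    ((StackSorting.U (2 * k + 1) {[3, 1, 2], [1, 3, 4, 2]}).ncard : ℚ) =
      1 / (2 * (k : ℚ) + 1) * ((3 * k).choose k : ℚ) := by
  rw [StackSorting.U_eq_ballotWords, (StackSorting.ncard_ballotWords_eq_walks (2 * k) k).1,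
    if_pos (by omega), show 2 * (2 * k) - k = 3 * k by omega,
    show 4 * k - 2 * (2 * k) = 0 by omega]
  exact StackSorting.walks_three_mul k
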